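/- Let $\overline{K}$ be an algebraic closure of a valued field $(K,v)$, let $\bar v$ be an extension of $v$ to $\overline{K}$, and let $\Gamma=\bar v(\overline{K}^*)$ be its value group, written additively (more generally, $(\overline K,\bar v)$ may be any algebraically closed valued field). *Quasi-cuts.* A quasi-cut in $\Gamma$ is a pair $\delta=(\delta^L,\delta^R)$ of subsets of $\Gamma$ with $\delta^L\cup\delta^R=\Gamma$ and $\alpha\le\beta$ for all $\alpha\in\delta^L$, $\beta\in\delta^R$. It is a cut if moreover $\alpha<\beta$ for all such $\alpha,\beta$ (so $\delta^L$ or $\delta^R$ may be empty). Each $\gamma\in\Gamma$ is identified with the quasi-cut $(\Gamma_{\le\gamma},\Gamma_{\ge\gamma})$; every quasi-cut is either an element of $\Gamma$ or a cut, and not both. Quasi-cuts are ordered by $\delta\le\epsilon$ if and only if $\delta^L\subseteq\epsilon^L$ and $\delta^R\supseteq\epsilon^R$. *Pointed balls.* For $a\in\overline K$ let $B(a,\delta)=\{c\in\overline K\mid \bar v(c-a)\ge\gamma\}$ if $\delta=\gamma\in\Gamma$, and $B(a,\delta)=\{c\in\overline K\mid \bar v(c-a)>\alpha\ \text{for all }\alpha\in\delta^L\}$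 if $\delta$ is a cut. The pointed ball $B^\bullet(a,\delta)$ is the pair $(B(a,\delta),\delta)$. The set $\mathbb B_{\mathrm{qcut}}$ of all pointed balls, for $a\in\overline K$ and $\delta$ a quasi-cut in $\Gamma$, is partially ordered by $$B^\bullet(a,\delta)\le B^\bullet(b,\epsilon)\iff B(a,\delta)\supseteq B(b,\epsilon)\ \text{ and }\ \delta\le\epsilon.$$ *Valuations.* Let $\mathbb V(\overline K)$ be the set of equivalence classes of valuations on $\overline K(x)$ whose restriction to $\overline K$ is equivalent to $\bar v$. Such a valuation $\mu$ with value group $\Gamma_\mu\supseteq\Gamma$ is valuation-transcendental if its residue field is transcendental over the residue field of $\bar v$ (residue-transcendental), or if $\Gamma_\mu/\Gamma$ is not a torsion group (value-transcendental). Let $\mathbb V_{\mathrm{fin}}(\overline K)\subseteq\mathbb V(\overline K)$ be the set of classes of valuation-transcendental valuations. It carries the partial order of $\mathbb V(\overline K)$, in which $\mu\le\nu$ if and only if $\mu$ and $\nu$ are equivalent, or for every nonzero $f\in\overline K[x]$ there is $\gamma\in\Gamma$ with $\mu(f)\le\gamma\le\nu(f)$. *The valuations $\omega_{a,\delta}$.*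 If $\delta=\gamma\in\Gamma$, put $x_\delta=\gamma\in\Gamma(\delta):=\Gamma$. If $\delta$ is a cut, let $\Gamma(\delta)=\mathbb Z x_\delta\oplus\Gamma$ for a formal symbol $x_\delta$, with the unique ordering that makes it an ordered abelian group, extends the ordering of $\Gamma$ and satisfies $\alpha<x_\delta$ for all $\alpha\in\delta^L$ and $x_\delta<\beta$ for all $\beta\in\delta^R$. Let $\omega_{a,\delta}$ be the $\Gamma(\delta)$-valued valuation on $\overline K(x)$ determined by $$\omega_{a,\delta}\Big(\sum_{n\ge0}a_n(x-a)^n\Big)=\min\{\bar v(a_n)+n x_\delta\mid n\ge0\}.$$ **Theorem.** The assignment $B^\bullet(a,\delta)\mapsto[\omega_{a,\delta}]$ is a well-defined map $\mathbb B_{\mathrm{qcut}}\to\mathbb V_{\mathrm{fin}}(\overline K)$, and it is an isomorphism of partially ordered sets. -/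

import Mathlib

universe u w

/-! ### Quasi-cuts and cuts of an ordered abelian group -/

/-- A quasi-cut of `Γ`: a pair of subsets with `left ≤ right` and `left ∪ right = Γ`. -/
@[ext]
structure QuasiCut (Γ : Type w) [LinearOrder Γ] where
  left : Set Γ
  right : Set Γ
  left_le_right : ∀ α ∈ left, ∀ β ∈ right, α ≤ β
  union_eq : left ∪ right = Set.univ

/-- A cut of `Γ`: a quasi-cut with `left < right`. -/
structure GroupCut (Γ : Type w) [LinearOrder Γ] extends QuasiCut Γ where
  left_lt_right : ∀ α ∈ left, ∀ β ∈ right, α < β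

namespace QuasiCut

variable {Γ : Type w} [LinearOrder Γ]

/-- `δ ≤ ε` if and only if `δ.left ⊆ ε.left` and `ε.right ⊆ δ.right`. -/
instance : PartialOrder (QuasiCut Γ) where
  le δ ε := δ.left ⊆ ε.left ∧ ε.right ⊆ δ.right
  le_refl _ := ⟨subset_rfl, subset_rfl⟩
  le_trans _ _ _ h k := ⟨h.1.trans k.1, k.2.trans h.2⟩
  le_antisymm _ _ h k := QuasiCut.ext (h.1.antisymm k.1) (k.2.antisymm h.2)

/-- The principal quasi-cut `(Γ_{≤ γ}, Γ_{≥ γ})` attached to `γ ∈ Γ`. -/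
def principal (γ : Γ) : QuasiCut Γ where
  left := Set.Iic γ
  right := Set.Ici γ
  left_le_right _ hα _ hβ := le_trans hα hβ
  union_eq := Set.Iic_union_Ici

/-- Every quasi-cut is an element of `Γ` or a cut. -/
theorem principal_or_cut (δ : QuasiCut Γ) :
    (∃ γ : Γ, δ = principal γ) ∨ ∃ ε : GroupCut Γ, δ = ε.toQuasiCut := by
  have hmem : ∀ α : Γ, α ∈ δ.left ∨ α ∈ δ.right := fun α => by
    have h : α ∈ δ.left ∪ δ.right := by rw [δ.union_eq]; trivial
    exact h
  by_cases h : ∃ γ, γ ∈ δ.left ∧ γ ∈ δ.right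
  · obtain ⟨γ, hl, hr⟩ := h
    refine Or.inl ⟨γ, QuasiCut.ext ?_ ?_⟩
    · ext α
      refine ⟨fun hα => δ.left_le_right α hα γ hr, fun hα => ?_⟩
      rcases hmem α with h | h
      · exact h
      · rwa [le_antisymm (show α ≤ γ from hα) (δ.left_le_right γ hl α h)]
    · ext α
      refine ⟨fun hα => δ.left_le_right γ hl α hα, fun hα => ?_⟩
      rcases hmem α with h | h
      · rwa [le_antisymm (δ.left_le_right α h γ hr) (show γ ≤ α from hα)]
      · exact h
  · push Not at h
    exact Or.inr ⟨⟨δ, fun α hα β hβ => lt_of_le_of_ne (δ.left_le_right α hα β hβ)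
      (fun e => h α hα (e ▸ hβ))⟩, rfl⟩

end QuasiCut

/-! ### The ordered group `ℤ x_δ ⊕ Γ` attached to a cut `δ` -/

/-- The group `Γ(δ) = ℤ x_δ ⊕ Γ`; the pair `(m, b)` stands for `m x_δ + b`. -/
def GroupCut.Ext {Γ : Type w} [LinearOrder Γ] (_δ : GroupCut Γ) : Type w := ℤ × Γ

namespace GroupCut

variable {Γ : Type w} [AddCommGroup Γ] [LinearOrder Γ] [IsOrderedAddMonoid Γ]

instance (δ : GroupCut Γ) : AddCommGroup δ.Ext := inferInstanceAs (AddCommGroup (ℤ × Γ))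

/-- The elements `m x_δ + b ≥ 0` of `Γ(δ)`. For `m > 0` this means that some `γ` in `δ.left`
satisfies `m γ + b ≥ 0`; for `m < 0`, that all `γ` in `δ.left` satisfy `m γ + b > 0`. -/
def IsNonneg (δ : GroupCut Γ) (z : ℤ × Γ) : Prop :=
  (z.1 = 0 ∧ 0 ≤ z.2) ∨ (0 < z.1 ∧ ∃ γ ∈ δ.left, 0 ≤ z.1 • γ + z.2) ∨
    (z.1 < 0 ∧ ∀ γ ∈ δ.left, 0 < z.1 • γ + z.2)

theorem IsNonneg.add {δ : GroupCut Γ} {y z : ℤ × Γ} (hy : δ.IsNonneg y) (hz : δ.IsNonneg z) :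
    δ.IsNonneg (y + z) := by
  obtain ⟨m, b⟩ := y
  obtain ⟨n, c⟩ := z
  have key : ∀ (m n : ℤ) (b c : Γ), 0 < m → n < 0 → (∃ γ ∈ δ.left, 0 ≤ m • γ + b) →
      (∀ γ ∈ δ.left, 0 < n • γ + c) → δ.IsNonneg (m + n, b + c) := by
    rintro m n b c hm hn ⟨γ, hγ, h⟩ h'
    have hs : ∀ α : Γ, (m + n) • α + (b + c) = (m • α + b) + (n • α + c) := fun α => by
      rw [add_smul]; abel
    rcases lt_trichotomy (m + n) 0 with e | e | e
    · refine Or.inr (Or.inr ⟨e, fun α hα => ?_⟩)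
      show 0 < (m + n) • α + (b + c)
      rcases le_total γ α with l | l
      · rw [hs]
        exact add_pos_of_nonneg_of_pos
          (h.trans (add_le_add_left (zsmul_le_zsmul_right hm.le l) b)) (h' α hα)
      · have h1 : 0 < (m + n) • γ + (b + c) := by
          rw [hs]; exact add_pos_of_nonneg_of_pos h (h' γ hγ)
        have h2 : (-(m + n)) • α ≤ (-(m + n)) • γ := zsmul_le_zsmul_right (by lia) l
        rw [neg_smul, neg_smul, neg_le_neg_iff] at h2
        exact h1.trans_le (add_le_add_left h2 _)
    · refine Or.inl ⟨e, ?_⟩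
      have h1 : 0 ≤ (m + n) • γ + (b + c) := by
        rw [hs]; exact (add_pos_of_nonneg_of_pos h (h' γ hγ)).le
      rwa [e, zero_smul, zero_add] at h1
    · refine Or.inr (Or.inl ⟨e, γ, hγ, ?_⟩)
      show 0 ≤ (m + n) • γ + (b + c)
      rw [hs]; exact (add_pos_of_nonneg_of_pos h (h' γ hγ)).le
  simp only [IsNonneg, Prod.mk_add_mk] at hy hz key ⊢
  rcases hy with ⟨hm, hb⟩ | ⟨hm, γ, hγ, hb⟩ | ⟨hm, hb⟩ <;>
    rcases hz with ⟨hn, hc⟩ | ⟨hn, γ', hγ', hc⟩ | ⟨hn, hc⟩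
  · exact Or.inl ⟨by lia, add_nonneg hb hc⟩
  · refine Or.inr (Or.inl ⟨by lia, γ', hγ', ?_⟩)
    rw [hm, zero_add, add_left_comm]; exact add_nonneg hb hc
  · refine Or.inr (Or.inr ⟨by lia, fun α hα => ?_⟩)
    rw [hm, zero_add, add_left_comm]; exact add_pos_of_nonneg_of_pos hb (hc α hα)
  · refine Or.inr (Or.inl ⟨by lia, γ, hγ, ?_⟩)
    rw [hn, add_zero, ← add_assoc]; exact add_nonneg hb hc
  · refine Or.inr (Or.inl ⟨by lia, ?_⟩)
    rcases le_total γ γ' with l | l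
    · refine ⟨γ', hγ', ?_⟩
      rw [add_smul, add_add_add_comm]
      exact add_nonneg (hb.trans (add_le_add_left (zsmul_le_zsmul_right hm.le l) b)) hc
    · refine ⟨γ, hγ, ?_⟩
      rw [add_smul, add_add_add_comm]
      exact add_nonneg hb (hc.trans (add_le_add_left (zsmul_le_zsmul_right hn.le l) c))
  · exact key m n b c hm hn ⟨γ, hγ, hb⟩ hc
  · refine Or.inr (Or.inr ⟨by lia, fun α hα => ?_⟩)
    rw [hn, add_zero, ← add_assoc]; exact add_pos_of_pos_of_nonneg (hb α hα) hc
  · have := key n m c b hn hm ⟨γ', hγ', hc⟩ hb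
    rwa [add_comm n m, add_comm c b] at this
  · refine Or.inr (Or.inr ⟨by lia, fun α hα => ?_⟩)
    rw [add_smul, add_add_add_comm]; exact add_pos (hb α hα) (hc α hα)

theorem isNonneg_or_neg (δ : GroupCut Γ) (z : ℤ × Γ) : δ.IsNonneg z ∨ δ.IsNonneg (-z) := by
  obtain ⟨m, b⟩ := z
  have hs : ∀ α : Γ, (-m) • α + -b = -(m • α + b) := fun α => by rw [neg_smul, neg_add]
  simp only [IsNonneg, Prod.neg_mk, hs, Left.neg_pos_iff, Left.nonneg_neg_iff]
  rcases lt_trichotomy m 0 with h | h | h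
  · by_cases k : ∀ γ ∈ δ.left, 0 < m • γ + b
    · exact Or.inl (Or.inr (Or.inr ⟨h, k⟩))
    · push Not at k
      exact Or.inr (Or.inr (Or.inl ⟨by lia, k⟩))
  · rcases le_total 0 b with k | k
    · exact Or.inl (Or.inl ⟨h, k⟩)
    · exact Or.inr (Or.inl ⟨by lia, k⟩)
  · by_cases k : ∃ γ ∈ δ.left, 0 ≤ m • γ + b
    · exact Or.inl (Or.inr (Or.inl ⟨h, k⟩))
    · push Not at k
      exact Or.inr (Or.inr (Or.inr ⟨by lia, k⟩))

theorem IsNonneg.eq_zero {δ : GroupCut Γ} {z : ℤ × Γ} (hz : δ.IsNonneg z)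
    (hz' : δ.IsNonneg (-z)) : z = 0 := by
  obtain ⟨m, b⟩ := z
  have hs : ∀ α : Γ, (-m) • α + -b = -(m • α + b) := fun α => by rw [neg_smul, neg_add]
  simp only [IsNonneg, Prod.neg_mk, hs, Left.neg_pos_iff, Left.nonneg_neg_iff] at hz hz'
  rcases hz with ⟨hm, hb⟩ | ⟨hm, γ, hγ, hb⟩ | ⟨hm, hb⟩ <;>
    rcases hz' with ⟨hn, hc⟩ | ⟨hn, γ', hγ', hc⟩ | ⟨hn, hc⟩
  all_goals first
    | (exfalso; lia)
    | exact Prod.ext hm (le_antisymm hc hb)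
    | exact absurd hb (not_le.mpr (hc _ hγ))
    | exact absurd hc (not_le.mpr (hb _ hγ'))

/-- The order of `Γ(δ)`: `y ≤ z` if and only if `z - y` is one of the elements singled out by
`IsNonneg`. It is a group ordering with `δ.left < x_δ < δ.right`, see below. -/
noncomputable instance (δ : GroupCut Γ) : LinearOrder δ.Ext where
  le y z := δ.IsNonneg (z - y : ℤ × Γ)
  le_refl y := by
    show δ.IsNonneg ((y : ℤ × Γ) - (y : ℤ × Γ))
    rw [sub_self]
    exact Or.inl ⟨rfl, le_rfl⟩
  le_trans x y z h k := by
    have := IsNonneg.add h k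
    have e : ((y : ℤ × Γ) - (x : ℤ × Γ)) + ((z : ℤ × Γ) - (y : ℤ × Γ)) = (z : ℤ × Γ) - x := by
      abel
    exact e ▸ this
  le_antisymm x y h k := by
    have e : -((y : ℤ × Γ) - (x : ℤ × Γ)) = (x : ℤ × Γ) - (y : ℤ × Γ) := neg_sub _ _
    have := IsNonneg.eq_zero h (e ▸ k)
    exact (sub_eq_zero.mp this).symm
  le_total x y := by
    have e : -((y : ℤ × Γ) - (x : ℤ × Γ)) = (x : ℤ × Γ) - (y : ℤ × Γ) := neg_sub _ _
    have := δ.isNonneg_or_neg ((y : ℤ × Γ) - (x : ℤ × Γ))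
    exact this.imp id (fun h => e ▸ h)
  toDecidableLE := Classical.decRel _

theorem le_def (δ : GroupCut Γ) (y z : δ.Ext) :
    y ≤ z ↔ δ.IsNonneg ((z : ℤ × Γ) - (y : ℤ × Γ)) := Iff.rfl

instance (δ : GroupCut Γ) : IsOrderedAddMonoid δ.Ext where
  add_le_add_left x y h z := by
    rw [le_def] at h ⊢
    have e : ((y + z : δ.Ext) : ℤ × Γ) - ((x + z : δ.Ext) : ℤ × Γ) =
      (y : ℤ × Γ) - (x : ℤ × Γ) := add_sub_add_right_eq_sub (G := ℤ × Γ) y x z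
    rw [e]
    exact h

/-- The formal symbol `x_δ`. -/
def x (δ : GroupCut Γ) : δ.Ext := ((1, 0) : ℤ × Γ)

/-- The inclusion `Γ → Γ(δ)`. -/
def incl (δ : GroupCut Γ) : Γ →+ δ.Ext := AddMonoidHom.inr ℤ Γ

theorem incl_strictMono (δ : GroupCut Γ) : StrictMono δ.incl := by
  refine Monotone.strictMono_of_injective (fun α β h => ?_) (fun α β h => congrArg Prod.snd h)
  rw [le_def]
  exact Or.inl ⟨sub_self (0 : ℤ), sub_nonneg.mpr h⟩

theorem incl_lt_x (δ : GroupCut Γ) {γ : Γ} (h : γ ∈ δ.left) : δ.incl γ < δ.x := by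
  refine lt_of_le_of_ne ?_ (fun e => zero_ne_one (congrArg Prod.fst e))
  rw [le_def]
  have e : (((1, 0) : ℤ × Γ) - ((0, γ) : ℤ × Γ)) = (1, -γ) := by simp
  show δ.IsNonneg (((1, 0) : ℤ × Γ) - ((0, γ) : ℤ × Γ))
  rw [e]
  exact Or.inr (Or.inl ⟨zero_lt_one, γ, h, by simp⟩)

theorem x_lt_incl (δ : GroupCut Γ) {γ : Γ} (h : γ ∈ δ.right) : δ.x < δ.incl γ := by
  refine lt_of_le_of_ne ?_ (fun e => one_ne_zero (congrArg Prod.fst e))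
  rw [le_def]
  have e : (((0, γ) : ℤ × Γ) - ((1, 0) : ℤ × Γ)) = (-1, γ) := by simp
  show δ.IsNonneg (((0, γ) : ℤ × Γ) - ((1, 0) : ℤ × Γ))
  rw [e]
  exact Or.inr (Or.inr ⟨by simp, fun α hα => by simpa using δ.left_lt_right α hα γ h⟩)

end GroupCut

/-! ### Monomial valuations -/

section Monomial

open Polynomial

variable {L : Type u} [Field L] {G : Type w} [AddCommGroup G] [LinearOrder G]
  [IsOrderedAddMonoid G]

/-- `min_n (u(a_n) + n x)` for the expansion `f = ∑ a_n (X - a)^n` (and `⊤` for `f = 0`). Note that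
`taylor a f = ∑ a_n X^n`. -/
noncomputable def monomialFun (u : AddValuation L (WithTop G)) (a : L) (x : G) (f : L[X]) :
    WithTop G :=
  (taylor a f).support.inf fun n => u ((taylor a f).coeff n) + ((n • x : G) : WithTop G)

theorem le_monomialFun_iff (u : AddValuation L (WithTop G)) (a : L) (x : G) (f : L[X])
    (g : WithTop G) : g ≤ monomialFun u a x f ↔
      ∀ n, g ≤ u ((taylor a f).coeff n) + ((n • x : G) : WithTop G) := by
  rw [monomialFun, Finset.le_inf_iff]
  refine ⟨fun h n => ?_, fun h n _ => h n⟩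
  by_cases hn : (taylor a f).coeff n = 0
  · rw [hn, AddValuation.map_zero, top_add]; exact le_top
  · exact h n (mem_support_iff.mpr hn)

theorem monomialFun_le (u : AddValuation L (WithTop G)) (a : L) (x : G) (f : L[X]) (n : ℕ) :
    monomialFun u a x f ≤ u ((taylor a f).coeff n) + ((n • x : G) : WithTop G) :=
  (le_monomialFun_iff u a x f _).mp le_rfl n

/-- For `f ≠ 0` the minimum is finite and is attained at a least index. -/
theorem exists_monomialFun_eq (u : AddValuation L (WithTop G)) (a : L) (x : G) {f : L[X]}
    (hf : f ≠ 0) : monomialFun u a x f ≠ ⊤ ∧ ∃ i,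
      u ((taylor a f).coeff i) + ((i • x : G) : WithTop G) = monomialFun u a x f ∧
      ∀ n < i, monomialFun u a x f < u ((taylor a f).coeff n) + ((n • x : G) : WithTop G) := by
  classical
  have hne : (taylor a f).support.Nonempty := by
    rw [support_nonempty]
    exact fun h => hf ((taylor_eq_zero a f).mp h)
  obtain ⟨i, hi, h⟩ := Finset.exists_mem_eq_inf _ hne
    (fun n => u ((taylor a f).coeff n) + ((n • x : G) : WithTop G))
  have hex : ∃ i, u ((taylor a f).coeff i) + ((i • x : G) : WithTop G) = monomialFun u a x f :=
    ⟨i, h.symm⟩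
  refine ⟨?_, Nat.find hex, Nat.find_spec hex, fun n hn =>
    lt_of_le_of_ne (monomialFun_le u a x f n) (Ne.symm (Nat.find_min hex hn))⟩
  show (taylor a f).support.inf _ ≠ ⊤
  rw [h]
  exact WithTop.add_ne_top.mpr
    ⟨(AddValuation.ne_top_iff u).mpr (mem_support_iff.mp hi), WithTop.coe_ne_top⟩

theorem monomialFun_mul (u : AddValuation L (WithTop G)) (a : L) (x : G) (f g : L[X]) :
    monomialFun u a x (f * g) = monomialFun u a x f + monomialFun u a x g := by
  classical
  have h0 : monomialFun u a x (0 : L[X]) = ⊤ := by simp [monomialFun]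
  rcases eq_or_ne f 0 with rfl | hf
  · rw [zero_mul, h0, top_add]
  rcases eq_or_ne g 0 with rfl | hg
  · rw [mul_zero, h0, add_top]
  obtain ⟨hft, i, hi, hi'⟩ := exists_monomialFun_eq u a x hf
  obtain ⟨hgt, j, hj, hj'⟩ := exists_monomialFun_eq u a x hg
  have hterm : ∀ k l : ℕ, u ((taylor a f).coeff k * (taylor a g).coeff l) +
      (((k + l) • x : G) : WithTop G) =
      (u ((taylor a f).coeff k) + ((k • x : G) : WithTop G)) +
        (u ((taylor a g).coeff l) + ((l • x : G) : WithTop G)) := fun k l => by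
    rw [AddValuation.map_mul, add_smul, WithTop.coe_add, add_add_add_comm]
  have hcancel : ∀ (y : WithTop G) (n : ℕ),
      y + ((-(n • x) : G) : WithTop G) + ((n • x : G) : WithTop G) = y := fun y n => by
    rw [add_assoc, ← WithTop.coe_add, neg_add_cancel, WithTop.coe_zero, add_zero]
  have hcancel' : ∀ (y : WithTop G) (n : ℕ),
      y + ((n • x : G) : WithTop G) + ((-(n • x) : G) : WithTop G) = y := fun y n => by
    rw [add_assoc, ← WithTop.coe_add, add_neg_cancel, WithTop.coe_zero, add_zero]
  apply le_antisymm
  · refine (monomialFun_le u a x (f * g) (i + j)).trans (le_of_eq ?_)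
    rw [← hi, ← hj, ← hterm]
    congr 1
    rw [taylor_mul, coeff_mul,
      ← Finset.add_sum_erase _ _ (Finset.HasAntidiagonal.mem_antidiagonal.mpr (rfl : (i, j).1 + (i, j).2 = i + j))]
    refine AddValuation.map_add_eq_of_lt_left u ?_
    refine AddValuation.map_lt_sum u ?_ ?_
    · rw [AddValuation.map_mul]
      refine WithTop.add_ne_top.mpr ⟨fun h => ?_, fun h => ?_⟩
      · rw [h, top_add] at hi; exact hft hi.symm
      · rw [h, top_add] at hj; exact hgt hj.symm
    · rintro ⟨k, l⟩ hkl
      obtain ⟨hne, hmem⟩ := Finset.mem_erase.mp hkl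
      have hsum : k + l = i + j := Finset.HasAntidiagonal.mem_antidiagonal.mp hmem
      show u ((taylor a f).coeff i * (taylor a g).coeff j) <
        u ((taylor a f).coeff k * (taylor a g).coeff l)
      have hlt : u ((taylor a f).coeff i * (taylor a g).coeff j) +
          (((i + j) • x : G) : WithTop G) <
          u ((taylor a f).coeff k * (taylor a g).coeff l) +
          (((i + j) • x : G) : WithTop G) := by
        rw [← hsum, hterm k l, hsum, hterm i j, hi, hj]
        rcases lt_or_ge k i with h | h
        · exact WithTop.add_lt_add_of_lt_of_le hgt (hi' k h) (monomialFun_le u a x g l)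
        · have hl : l < j := by
            rcases eq_or_lt_of_le h with e | e
            · exact absurd (Prod.ext e.symm (by simp; lia)) hne
            · lia
          exact WithTop.add_lt_add_of_le_of_lt hft (monomialFun_le u a x f k) (hj' l hl)
      exact lt_of_add_lt_add_right hlt
  · rw [le_monomialFun_iff]
    intro n
    rw [taylor_mul, coeff_mul]
    rw [← hcancel (monomialFun u a x f + monomialFun u a x g) n]
    refine add_le_add_left ?_ _
    refine AddValuation.map_le_sum u ?_
    rintro ⟨k, l⟩ hkl
    have hsum : k + l = n := Finset.HasAntidiagonal.mem_antidiagonal.mp hkl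
    show _ ≤ u ((taylor a f).coeff k * (taylor a g).coeff l)
    rw [← hcancel' (u ((taylor a f).coeff k * (taylor a g).coeff l)) n]
    refine add_le_add_left ?_ _
    rw [← hsum, hterm]
    exact add_le_add (monomialFun_le u a x f k) (monomialFun_le u a x g l)

theorem monomialFun_C (u : AddValuation L (WithTop G)) (a : L) (x : G) (c : L) :
    monomialFun u a x (C c) = u c := by
  rcases eq_or_ne c 0 with rfl | hc
  · simp [monomialFun]
  · simp [monomialFun, support_C hc]

/-- The monomial valuation on `L[X]`. -/
noncomputable def monomialPolyVal (u : AddValuation L (WithTop G)) (a : L) (x : G) :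
    AddValuation L[X] (WithTop G) :=
  AddValuation.of (monomialFun u a x) (by simp [monomialFun])
    (by rw [← C_1, monomialFun_C, AddValuation.map_one])
    (fun f g => by
      rw [le_monomialFun_iff]
      intro n
      rw [map_add, coeff_add]
      rcases AddValuation.map_add' u ((taylor a f).coeff n) ((taylor a g).coeff n) with h | h
      · exact (min_le_left _ _).trans ((monomialFun_le u a x f n).trans (by gcongr))
      · exact (min_le_right _ _).trans ((monomialFun_le u a x g n).trans (by gcongr)))
    (monomialFun_mul u a x)

theorem nonZeroDivisors_le_primeCompl (u : AddValuation L (WithTop G)) (a : L) (x : G) :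
    nonZeroDivisors L[X] ≤ (AddValuation.toValuation (monomialPolyVal u a x)).supp.primeCompl :=
  fun _ hf hf' => (exists_monomialFun_eq u a x (nonZeroDivisors.ne_zero hf)).1 hf'

/-- The monomial valuation on `L(X)`: the unique valuation extending `monomialPolyVal`. -/
noncomputable def monomialVal (u : AddValuation L (WithTop G)) (a : L) (x : G) :
    AddValuation (RatFunc L) (WithTop G) :=
  AddValuation.ofValuation <|
    Valuation.extendToLocalization (Γ := Multiplicative (WithTop G)ᵒᵈ)
      (AddValuation.toValuation (monomialPolyVal u a x))
      (nonZeroDivisors_le_primeCompl u a x) (RatFunc L)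

theorem monomialVal_algebraMap (u : AddValuation L (WithTop G)) (a : L) (x : G) (f : L[X]) :
    monomialVal u a x (algebraMap L[X] (RatFunc L) f) = monomialFun u a x f :=
  Valuation.extendToLocalization_apply_map_apply (Γ := Multiplicative (WithTop G)ᵒᵈ)
    _ (nonZeroDivisors_le_primeCompl u a x) (RatFunc L) f

theorem monomialVal_const (u : AddValuation L (WithTop G)) (a : L) (x : G) (c : L) :
    monomialVal u a x (algebraMap L (RatFunc L) c) = u c := by
  rw [IsScalarTower.algebraMap_apply L L[X] (RatFunc L), monomialVal_algebraMap]
  exact monomialFun_C u a x c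

end Monomial

/-! ### Equivalence classes of valuations on `L(X)` and their partial order -/

section Classes

open Polynomial

variable {L : Type u} [Field L] {Γ : Type w} [AddCommGroup Γ] [LinearOrder Γ]
  [IsOrderedAddMonoid Γ]

/-- A valuation on `L(X)`, with values in an arbitrary ordered abelian group, whose restriction to
`L` is equivalent to `v`. -/
structure ValExt (v : AddValuation L (WithTop Γ)) where
  G : Type w
  [addCommGroup : AddCommGroup G]
  [linearOrder : LinearOrder G]
  [isOrderedAddMonoid : IsOrderedAddMonoid G]
  val : AddValuation (RatFunc L) (WithTop G)
  isEquiv : v.IsEquiv (val.comap (algebraMap L (RatFunc L)))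

attribute [instance] ValExt.addCommGroup ValExt.linearOrder ValExt.isOrderedAddMonoid

namespace ValExt

variable {v : AddValuation L (WithTop Γ)}

instance (μ : ValExt v) :
    (AddValuation.toValuation v).HasExtension (AddValuation.toValuation μ.val) :=
  ⟨μ.isEquiv⟩

/-- Value-transcendental: the value group of `μ` is not a torsion group modulo the value group of
`L`, that is, no positive multiple of some value `μ f` is a value of an element of `L`. -/
def IsValueTranscendental (μ : ValExt v) : Prop :=
  ∃ f : RatFunc L, f ≠ 0 ∧ ∀ n : ℕ, 0 < n → ∀ c : L, c ≠ 0 →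
    n • μ.val f ≠ μ.val (algebraMap L (RatFunc L) c)

/-- Residue-transcendental: the residue field of `μ` is a transcendental extension of the residue
field of `v`. -/
def IsResidueTranscendental (μ : ValExt v) : Prop :=
  Algebra.Transcendental
    (IsLocalRing.ResidueField (AddValuation.toValuation v).valuationSubring)
    (IsLocalRing.ResidueField (AddValuation.toValuation μ.val).valuationSubring)

/-- Valuation-transcendental: residue-transcendental or value-transcendental. -/
def IsValuationTranscendental (μ : ValExt v) : Prop :=
  μ.IsResidueTranscendental ∨ μ.IsValueTranscendental

/-- Equivalence of valuations on `L(X)`. -/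
instance setoid (v : AddValuation L (WithTop Γ)) : Setoid (ValExt v) where
  r μ ν := μ.val.IsEquiv ν.val
  iseqv := ⟨fun _ => .refl, fun h => h.symm, fun h k => h.trans k⟩

/-- `μ ≤ ν`: either `μ` and `ν` are equivalent, or for every nonzero polynomial `f` there is a value
`γ = v c` of `L` with `μ f ≤ γ ≤ ν f`. (The element `γ` of the value group of `L` is identified with
`μ c` in the value group of `μ`, and with `ν c` in that of `ν`.) -/
def Le (μ ν : ValExt v) : Prop :=
  μ.val.IsEquiv ν.val ∨ ∀ f : L[X], f ≠ 0 → ∃ c : L, c ≠ 0 ∧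
    μ.val (algebraMap L[X] (RatFunc L) f) ≤ μ.val (algebraMap L (RatFunc L) c) ∧
    ν.val (algebraMap L (RatFunc L) c) ≤ ν.val (algebraMap L[X] (RatFunc L) f)

theorem const_le_iff (μ ν : ValExt v) (c d : L) :
    μ.val (algebraMap L (RatFunc L) c) ≤ μ.val (algebraMap L (RatFunc L) d) ↔
      ν.val (algebraMap L (RatFunc L) c) ≤ ν.val (algebraMap L (RatFunc L) d) := by
  have h := μ.isEquiv.symm.trans ν.isEquiv
  exact h d c

theorem val_le_iff {μ ν : ValExt v} (h : μ.val.IsEquiv ν.val) (f g : RatFunc L) :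
    μ.val f ≤ μ.val g ↔ ν.val f ≤ ν.val g := h g f

theorem Le.congr {μ μ' ν ν' : ValExt v} (hμ : μ.val.IsEquiv μ'.val) (hν : ν.val.IsEquiv ν'.val)
    (h : Le μ ν) : Le μ' ν' := by
  rcases h with h | h
  · exact Or.inl (hμ.symm.trans (h.trans hν))
  · refine Or.inr fun f hf => ?_
    obtain ⟨c, hc, h1, h2⟩ := h f hf
    exact ⟨c, hc, (val_le_iff hμ _ _).mp h1, (val_le_iff hν _ _).mp h2⟩

theorem Le.trans {μ ν ρ : ValExt v} (h : Le μ ν) (k : Le ν ρ) : Le μ ρ := by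
  rcases id h with h' | h'
  · exact Le.congr h'.symm .refl k
  rcases id k with k' | k'
  · exact Le.congr .refl k' h
  · refine Or.inr fun f hf => ?_
    obtain ⟨c, hc, h1, h2⟩ := h' f hf
    obtain ⟨d, hd, h3, h4⟩ := k' f hf
    exact ⟨c, hc, h1, ((const_le_iff ν ρ c d).mp (h2.trans h3)).trans h4⟩

theorem Le.antisymm {μ ν : ValExt v} (h : Le μ ν) (k : Le ν μ) : μ.val.IsEquiv ν.val := by
  rcases h with h | h
  · exact h
  rcases k with k | k
  · exact k.symm
  have key : ∀ f : L[X], f ≠ 0 → ∃ c : L, c ≠ 0 ∧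
      μ.val (algebraMap L[X] (RatFunc L) f) = μ.val (algebraMap L (RatFunc L) c) ∧
      ν.val (algebraMap L[X] (RatFunc L) f) = ν.val (algebraMap L (RatFunc L) c) := fun f hf => by
    obtain ⟨c, hc, h1, h2⟩ := h f hf
    obtain ⟨d, hd, h3, h4⟩ := k f hf
    have h5 := (const_le_iff ν μ c d).mp (h2.trans h3)
    have h6 := (const_le_iff μ ν d c).mp (h4.trans h1)
    exact ⟨c, hc, le_antisymm h1 (h5.trans h4), le_antisymm (h3.trans h6) h2⟩
  have key' : ∀ f : RatFunc L, f ≠ 0 → ∃ c : L, c ≠ 0 ∧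
      μ.val f = μ.val (algebraMap L (RatFunc L) c) ∧
      ν.val f = ν.val (algebraMap L (RatFunc L) c) := fun f hf => by
    obtain ⟨p, q, hq, rfl⟩ := IsFractionRing.div_surjective (A := L[X]) f
    have hq0 : q ≠ 0 := nonZeroDivisors.ne_zero hq
    have hp0 : p ≠ 0 := fun e => hf (by rw [e, map_zero, zero_div])
    obtain ⟨c, hc, h1, h2⟩ := key p hp0
    obtain ⟨d, hd, h3, h4⟩ := key q hq0
    refine ⟨c / d, div_ne_zero hc hd, ?_, ?_⟩
    · rw [map_div₀ (algebraMap L (RatFunc L)), AddValuation.map_div, AddValuation.map_div, h1, h3]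
    · rw [map_div₀ (algebraMap L (RatFunc L)), AddValuation.map_div, AddValuation.map_div, h2, h4]
  have key'' : ∀ f : RatFunc L, ∃ c : L,
      μ.val f = μ.val (algebraMap L (RatFunc L) c) ∧
      ν.val f = ν.val (algebraMap L (RatFunc L) c) := fun f => by
    rcases eq_or_ne f 0 with rfl | hf
    · exact ⟨0, by rw [map_zero (algebraMap L (RatFunc L))], by rw [map_zero (algebraMap L (RatFunc L))]⟩
    · obtain ⟨c, -, h⟩ := key' f hf
      exact ⟨c, h⟩
  intro f g
  obtain ⟨c, h1, h2⟩ := key'' f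
  obtain ⟨d, h3, h4⟩ := key'' g
  show μ.val g ≤ μ.val f ↔ ν.val g ≤ ν.val f
  rw [h1, h2, h3, h4]
  exact const_le_iff μ ν d c

end ValExt

/-- The set `𝕍(L)` of equivalence classes of valuations on `L(X)` whose restriction to `L` is
equivalent to `v`. -/
def ValClass (v : AddValuation L (WithTop Γ)) := Quotient (ValExt.setoid v)

/-- The equivalence class of `μ`. -/
def ValExt.toClass {v : AddValuation L (WithTop Γ)} (μ : ValExt v) : ValClass v :=
  Quotient.mk _ μ

instance (v : AddValuation L (WithTop Γ)) : PartialOrder (ValClass v) where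
  le := Quotient.lift₂ ValExt.Le fun _ _ _ _ h k =>
    propext ⟨ValExt.Le.congr h k, ValExt.Le.congr h.symm k.symm⟩
  le_refl := Quotient.ind fun _ => Or.inl .refl
  le_trans x y z := Quotient.inductionOn₃ x y z fun _ _ _ => ValExt.Le.trans
  le_antisymm x y := Quotient.inductionOn₂ x y fun _ _ h k =>
    Quotient.sound (ValExt.Le.antisymm h k)

/-- The poset `𝕍_fin(L)` of classes of valuation-transcendental valuations, with the order of
`𝕍(L)`. -/
abbrev ValTransClass (v : AddValuation L (WithTop Γ)) :=
  {q : ValClass v // ∃ μ : ValExt v, μ.IsValuationTranscendental ∧ μ.toClass = q}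

/-- The valuation `ω_{a,γ}` for `γ ∈ Γ`, with values in `Γ`:
`ω_{a,γ}(∑ a_n (x - a)^n) = min_n (v a_n + n γ)`. -/
noncomputable def omegaElem (v : AddValuation L (WithTop Γ)) (a : L) (γ : Γ) : ValExt v where
  G := Γ
  val := monomialVal v a γ
  isEquiv c d := by
    show v d ≤ v c ↔ monomialVal v a γ (algebraMap L (RatFunc L) d) ≤
      monomialVal v a γ (algebraMap L (RatFunc L) c)
    rw [monomialVal_const, monomialVal_const]

/-- The valuation `v` with its values regarded in `Γ(δ)`. -/
noncomputable def cutBaseVal (v : AddValuation L (WithTop Γ)) (δ : GroupCut Γ) :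
    AddValuation L (WithTop δ.Ext) :=
  v.map δ.incl.withTopMap rfl δ.incl_strictMono.withTop_map.monotone

/-- The valuation `ω_{a,δ}` for a cut `δ`, with values in `Γ(δ)`:
`ω_{a,δ}(∑ a_n (x - a)^n) = min_n (v a_n + n x_δ)`. -/
noncomputable def omegaCut (v : AddValuation L (WithTop Γ)) (a : L) (δ : GroupCut Γ) :
    ValExt v where
  G := δ.Ext
  val := monomialVal (cutBaseVal v δ) a δ.x
  isEquiv c d := by
    show v d ≤ v c ↔ monomialVal (cutBaseVal v δ) a δ.x (algebraMap L (RatFunc L) d) ≤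
      monomialVal (cutBaseVal v δ) a δ.x (algebraMap L (RatFunc L) c)
    rw [monomialVal_const, monomialVal_const]
    exact (δ.incl_strictMono.withTop_map.le_iff_le).symm

/-! ### Pointed balls -/

/-- The ball of centre `a` and radius `δ`: it is `{c | v (c - a) ≥ γ}` if `δ = γ ∈ Γ`, and
`{c | v (c - a) > δ.left}` if `δ` is a cut. The elements of `δ.left` that do not belong to `δ.right`
are all elements of `δ.left` if `δ` is a cut, and all except `γ` if `δ = γ`. -/
def qball (v : AddValuation L (WithTop Γ)) (a : L) (δ : QuasiCut Γ) : Set L :=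
  {c | ∀ α ∈ δ.left, (α : WithTop Γ) ≤ v (c - a) ∧ (α ∉ δ.right → (α : WithTop Γ) < v (c - a))}

theorem qball_principal (v : AddValuation L (WithTop Γ)) (a : L) (γ : Γ) :
    qball v a (QuasiCut.principal γ) = {c | (γ : WithTop Γ) ≤ v (c - a)} := by
  ext c
  refine ⟨fun h => (h γ le_rfl).1, fun h α hα => ⟨?_, fun hα' => ?_⟩⟩
  · exact (WithTop.coe_le_coe.mpr hα).trans h
  · exact (WithTop.coe_lt_coe.mpr (not_le.mp hα')).trans_le h

theorem qball_cut (v : AddValuation L (WithTop Γ)) (a : L) (δ : GroupCut Γ) :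
    qball v a δ.toQuasiCut = {c | ∀ α ∈ δ.left, (α : WithTop Γ) < v (c - a)} := by
  ext c
  exact ⟨fun h α hα => (h α hα).2 fun hα' => lt_irrefl α (δ.left_lt_right α hα α hα'),
    fun h α hα => ⟨(h α hα).le, fun _ => h α hα⟩⟩

/-- A pointed ball: an underlying ball together with its radius. -/
@[ext]
structure PointedBall (v : AddValuation L (WithTop Γ)) where
  under : Set L
  radius : QuasiCut Γ
  exists_center : ∃ a : L, under = qball v a radius

namespace PointedBall

/-- The pointed ball `B•(a, δ) = (B(a, δ), δ)`. -/
def ofCenter (v : AddValuation L (WithTop Γ)) (a : L) (δ : QuasiCut Γ) : PointedBall v :=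
  ⟨qball v a δ, δ, a, rfl⟩

/-- Reverse inclusion of the underlying balls together with `≤` on radii. -/
instance (v : AddValuation L (WithTop Γ)) : PartialOrder (PointedBall v) where
  le B C := C.under ⊆ B.under ∧ B.radius ≤ C.radius
  le_refl _ := ⟨subset_rfl, le_rfl⟩
  le_trans _ _ _ h k := ⟨k.1.trans h.1, h.2.trans k.2⟩
  le_antisymm _ _ h k := PointedBall.ext (k.1.antisymm h.1) (le_antisymm h.2 k.2)

end PointedBall

end Classes

/-! Over an algebraically closed `L`, a valuation on `L(X)` is determined on polynomials by its
values on constants and on the `X - c`. Suppose `μ (X - a)` is the largest of the latter. Then `μ (X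
- c) = min (μ (X - a)) (v (c - a))`, and the position of `μ (X - a)` relative to `Γ` is a quasi-cut
`δ`; this is `IsMonomialAt`. The pair `(a, δ)` fixes `μ` up to equivalence (`IsMonomialAt.isEquiv`):
comparing `m μ (X - a)` with a constant reduces to `m = 1`, because constants have `m`-th roots. The
points that can replace `a` are exactly those of the ball `B(a, δ)`, so pointed balls are the right
invariants. Every pair `(a, δ)` occurs, through `ω_{a,δ}`.

The maximum exists exactly for valuation-transcendental `μ` (`isValuationTranscendental_iff`).
Without it, every nonzero rational function is a constant times a 1-unit, so neither the value group
nor the residue field grows. With it, either `μ (X - a)` is not the value of a constant, and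
divisibility of `Γ` makes it non-torsion, or `μ (X - a) = μ d` and the residue of `(X - a)/d` is
transcendental.

For the order, comparing `μ` and `ν` on `X - a` gives the inclusion of balls and the inequality of
radii. Conversely, two distinct comparable radii have an element of `Γ` between them, which yields
the interpolating constant on each linear factor, hence on products. -/

open Polynomial

/-! ### Linear polynomials and reduction to them -/

section Linear

variable {L : Type u} [Field L]

/-- The linear polynomial `X - a`, as an element of `L(X)`. -/
noncomputable def linearFun (a : L) : RatFunc L := algebraMap L[X] (RatFunc L) (X - C a)

theorem linearFun_ne_zero (a : L) : linearFun a ≠ 0 := by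
  rw [linearFun, Ne, FaithfulSMul.algebraMap_eq_zero_iff]
  exact X_sub_C_ne_zero a

theorem linearFun_eq_add (a b : L) :
    linearFun b = linearFun a + algebraMap L (RatFunc L) (a - b) := by
  rw [linearFun, linearFun, IsScalarTower.algebraMap_apply L L[X] (RatFunc L), ← map_add]
  congr 1
  rw [algebraMap_eq, C_sub]
  ring

/-- Over an algebraically closed field, a multiplicative property of nonzero constants and linear
polynomials holds for all nonzero polynomials. -/
theorem polynomial_induction [IsAlgClosed L] {P : RatFunc L → Prop}
    (hC : ∀ c : L, c ≠ 0 → P (algebraMap L (RatFunc L) c)) (hX : ∀ a : L, P (linearFun a))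
    (hmul : ∀ f g, P f → P g → P (f * g)) {f : L[X]} (hf : f ≠ 0) :
    P (algebraMap L[X] (RatFunc L) f) := by
  rw [(IsAlgClosed.splits f).eq_prod_roots, map_mul, map_multiset_prod, Multiset.map_map]
  refine hmul _ _ ?_ (Multiset.prod_induction P _ hmul ?_ ?_)
  · rw [← algebraMap_eq, ← IsScalarTower.algebraMap_apply L L[X] (RatFunc L)]
    exact hC _ (leadingCoeff_ne_zero.mpr hf)
  · rw [← map_one (algebraMap L (RatFunc L))]
    exact hC 1 one_ne_zero
  · intro g hg
    obtain ⟨a, -, rfl⟩ := Multiset.mem_map.mp hg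
    exact hX a

/-- Over an algebraically closed field, a multiplicative property of nonzero constants and linear
polynomials that is stable under inversion holds for all nonzero rational functions. -/
theorem ratFunc_induction [IsAlgClosed L] {P : RatFunc L → Prop}
    (hC : ∀ c : L, c ≠ 0 → P (algebraMap L (RatFunc L) c)) (hX : ∀ a : L, P (linearFun a))
    (hmul : ∀ f g, P f → P g → P (f * g)) (hinv : ∀ f, f ≠ 0 → P f → P f⁻¹)
    {f : RatFunc L} (hf : f ≠ 0) : P f := by
  obtain ⟨p, q, hq, rfl⟩ := IsFractionRing.div_surjective (A := L[X]) f
  have hq0 : q ≠ 0 := nonZeroDivisors.ne_zero hq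
  have hp0 : p ≠ 0 := fun e => hf (by rw [e, map_zero, zero_div])
  rw [div_eq_mul_inv]
  refine hmul _ _ (polynomial_induction hC hX hmul hp0)
    (hinv _ ?_ (polynomial_induction hC hX hmul hq0))
  rwa [Ne, FaithfulSMul.algebraMap_eq_zero_iff]

end Linear

/-- Between two distinct comparable quasi-cuts there is an element of the group. -/
theorem QuasiCut.exists_mem_of_lt {Γ : Type w} [LinearOrder Γ] {δ ε : QuasiCut Γ} (h : δ ≤ ε)
    (hne : δ ≠ ε) : ∃ γ, γ ∈ δ.right ∧ γ ∈ ε.left := by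
  by_contra! k
  have hδ : ∀ γ, γ ∉ δ.left → γ ∈ δ.right := fun γ hγ => by
    have : γ ∈ δ.left ∪ δ.right := by rw [δ.union_eq]; trivial
    exact this.resolve_left hγ
  have hε : ∀ γ, γ ∉ ε.left → γ ∈ ε.right := fun γ hγ => by
    have : γ ∈ ε.left ∪ ε.right := by rw [ε.union_eq]; trivial
    exact this.resolve_left hγ
  -- If `δ.right` and `ε.left` are disjoint, the covering conditions force `ε ≤ δ`.
  refine hne (le_antisymm h ⟨fun γ hγ => ?_, fun γ hγ => hε γ (k γ hγ)⟩)
  by_contra hn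
  exact k γ (hδ γ hn) hγ

/-! ### Centre and radius of a valuation -/

namespace ValExt

variable {L : Type u} [Field L] {Γ : Type w} [AddCommGroup Γ] [LinearOrder Γ]
  [IsOrderedAddMonoid Γ] {v : AddValuation L (WithTop Γ)}

theorem val_const_le_iff (μ : ValExt v) (c d : L) :
    μ.val (algebraMap L (RatFunc L) c) ≤ μ.val (algebraMap L (RatFunc L) d) ↔ v c ≤ v d :=
  (μ.isEquiv d c).symm

theorem val_const_lt_iff (μ : ValExt v) (c d : L) :
    μ.val (algebraMap L (RatFunc L) c) < μ.val (algebraMap L (RatFunc L) d) ↔ v c < v d := by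
  rw [← not_le, ← not_le, val_const_le_iff]

theorem val_const_eq_iff (μ : ValExt v) (c d : L) :
    μ.val (algebraMap L (RatFunc L) c) = μ.val (algebraMap L (RatFunc L) d) ↔ v c = v d := by
  rw [le_antisymm_iff, le_antisymm_iff, val_const_le_iff, val_const_le_iff]

theorem zero_le_val_inv_mul_iff (μ : ValExt v) {f g : RatFunc L} (hf : f ≠ 0) :
    0 ≤ μ.val (f⁻¹ * g) ↔ μ.val f ≤ μ.val g := by
  have h : μ.val f ≠ ⊤ := (AddValuation.ne_top_iff _).mpr hf
  have e : μ.val g = μ.val f + μ.val (f⁻¹ * g) := by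
    rw [← AddValuation.map_mul, mul_inv_cancel_left₀ hf]
  rw [e]
  constructor
  · intro k
    exact le_add_of_nonneg_right k
  · intro k
    exact (WithTop.add_le_add_iff_left h).mp (by rwa [add_zero])

/-- Positive multiples preserve signs in an ordered group; this is what makes extracting roots of
constants useful. -/
theorem zero_le_val_pow_iff (μ : ValExt v) (f : RatFunc L) {n : ℕ} (hn : 0 < n) :
    0 ≤ μ.val (f ^ n) ↔ 0 ≤ μ.val f := by
  rw [AddValuation.map_pow]
  refine ⟨fun h => ?_, fun h => nsmul_nonneg h n⟩
  by_contra! k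
  exact not_lt.mpr h ((nsmul_neg_iff hn.ne').mpr k)

/-- `a` is the centre and `δ` the radius of the valuation `μ`: the value `μ (X - a)` is the largest
of the values `μ (X - c)`, and its position relative to the value group of `L` is given by `δ`. -/
structure IsMonomialAt (μ : ValExt v) (a : L) (δ : QuasiCut Γ) : Prop where
  le_max : ∀ c, μ.val (linearFun c) ≤ μ.val (linearFun a)
  mem_left : ∀ (d : L) (γ : Γ), v d = γ →
    (γ ∈ δ.left ↔ μ.val (algebraMap L (RatFunc L) d) ≤ μ.val (linearFun a))
  mem_right : ∀ (d : L) (γ : Γ), v d = γ →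
    (γ ∈ δ.right ↔ μ.val (linearFun a) ≤ μ.val (algebraMap L (RatFunc L) d))

theorem exists_coe (v : AddValuation L (WithTop Γ)) {d : L} (hd : d ≠ 0) : ∃ γ : Γ, v d = γ :=
  ⟨(v d).untop ((AddValuation.ne_top_iff v).mpr hd), (WithTop.coe_untop _ _).symm⟩

theorem linear_le_linear_of_le {μ : ValExt v} {a b : L}
    (h : μ.val (linearFun a) ≤ μ.val (algebraMap L (RatFunc L) (b - a))) :
    μ.val (linearFun a) ≤ μ.val (linearFun b) := by
  rw [linearFun_eq_add a b, ← neg_sub b a, map_neg]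
  exact AddValuation.map_le_add _ le_rfl (by rwa [AddValuation.map_neg])

/-- Strict ultrametric case of `X - c = (X - a) + (a - c)`. Maximality at `a` is not assumed, so `a`
need not be a centre; `Le.qball_subset` relies on this. -/
theorem linear_eq_of_lt {μ : ValExt v} {a c : L}
    (h : μ.val (algebraMap L (RatFunc L) (c - a)) < μ.val (linearFun a)) :
    μ.val (linearFun c) = μ.val (algebraMap L (RatFunc L) (c - a)) := by
  have e : μ.val (algebraMap L (RatFunc L) (c - a)) = μ.val (algebraMap L (RatFunc L) (a - c)) := by
    rw [← neg_sub, map_neg, AddValuation.map_neg]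
  rw [e] at h ⊢
  rw [linearFun_eq_add a c]
  exact AddValuation.map_add_eq_of_lt_right _ h

/-- Only a tie between the two terms could make the value exceed the minimum, and maximality at `a`
rules that out. -/
theorem IsMonomialAt.linear_eq {μ : ValExt v} {a : L} {δ : QuasiCut Γ} (h : μ.IsMonomialAt a δ)
    (c : L) : μ.val (linearFun c) =
      min (μ.val (linearFun a)) (μ.val (algebraMap L (RatFunc L) (c - a))) := by
  rcases le_or_gt (μ.val (linearFun a)) (μ.val (algebraMap L (RatFunc L) (c - a))) with k | k
  · rw [min_eq_left k]
    exact le_antisymm (h.le_max c) (linear_le_linear_of_le k)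
  · rw [min_eq_right k.le, linear_eq_of_lt k]

/-- The ball of centre `a` and radius `δ` consists of the points where `μ (X - c)` is maximal. -/
theorem IsMonomialAt.mem_qball_iff {μ : ValExt v} {a : L} {δ : QuasiCut Γ}
    (hv : ∀ γ : Γ, ∃ c : L, v c = (γ : WithTop Γ)) (h : μ.IsMonomialAt a δ) (c : L) :
    c ∈ qball v a δ ↔ μ.val (linearFun a) ≤ μ.val (algebraMap L (RatFunc L) (c - a)) := by
  constructor
  · intro hc
    by_contra! k
    have hne : c - a ≠ 0 := fun e => by simp [e] at k
    obtain ⟨γ, hγ⟩ := exists_coe v hne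
    have hl := (h.mem_left _ γ hγ).mpr k.le
    -- Here `γ = v (c - a)` lies in `δ.left` but not in `δ.right`, so the strict clause of `qball`
    -- would give `γ < γ`.
    have := (hc γ hl).2 fun hr => not_le.mpr k ((h.mem_right _ γ hγ).mp hr)
    rw [hγ] at this
    exact lt_irrefl _ this
  · intro hc α hα
    obtain ⟨d, hd⟩ := hv α
    rw [← hd, ← val_const_le_iff μ, ← val_const_lt_iff μ]
    refine ⟨((h.mem_left d α hd).mp hα).trans hc, fun hr => ?_⟩
    exact (not_le.mp fun k => hr ((h.mem_right d α hd).mpr k)).trans_le hc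

/-- As for any ultrametric ball, each point is a centre. This makes the attached valuation
independent of the chosen centre. -/
theorem IsMonomialAt.of_mem_qball {μ : ValExt v} {a b : L} {δ : QuasiCut Γ}
    (hv : ∀ γ : Γ, ∃ c : L, v c = (γ : WithTop Γ)) (h : μ.IsMonomialAt a δ)
    (hb : b ∈ qball v a δ) : μ.IsMonomialAt b δ := by
  have e : μ.val (linearFun b) = μ.val (linearFun a) := by
    rw [h.linear_eq b, min_eq_left ((h.mem_qball_iff hv b).mp hb)]
  exact ⟨by rw [e]; exact h.le_max, by rw [e]; exact h.mem_left, by rw [e]; exact h.mem_right⟩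

theorem self_mem_qball (a : L) (δ : QuasiCut Γ) : a ∈ qball v a δ := fun α _ => by
  simp

/-- The centre and the radius determine the valuation up to equivalence. -/
theorem IsMonomialAt.isEquiv [IsAlgClosed L] {μ ν : ValExt v} {a : L} {δ : QuasiCut Γ}
    (hμ : μ.IsMonomialAt a δ) (hν : ν.IsMonomialAt a δ) : μ.val.IsEquiv ν.val := by
  have le_iff : ∀ d : L, d ≠ 0 → (μ.val (algebraMap L (RatFunc L) d) ≤ μ.val (linearFun a) ↔
      ν.val (algebraMap L (RatFunc L) d) ≤ ν.val (linearFun a)) := fun d hd => by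
    obtain ⟨γ, hγ⟩ := exists_coe v hd
    rw [← hμ.mem_left d γ hγ, hν.mem_left d γ hγ]
  have ge_iff : ∀ d : L, d ≠ 0 → (μ.val (linearFun a) ≤ μ.val (algebraMap L (RatFunc L) d) ↔
      ν.val (linearFun a) ≤ ν.val (algebraMap L (RatFunc L) d)) := fun d hd => by
    obtain ⟨γ, hγ⟩ := exists_coe v hd
    rw [← hμ.mem_right d γ hγ, hν.mem_right d γ hγ]
  -- The same monomial `d (X - a)^n` represents `f` for both valuations: both fall into the same
  -- case of the minimum in `linear_eq`.
  have form : ∀ f : RatFunc L, f ≠ 0 → ∃ (d : L) (n : ℤ), d ≠ 0 ∧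
      μ.val f = μ.val (algebraMap L (RatFunc L) d * linearFun a ^ n) ∧
      ν.val f = ν.val (algebraMap L (RatFunc L) d * linearFun a ^ n) := by
    intro f hf
    refine ratFunc_induction (P := fun f => ∃ (d : L) (n : ℤ), d ≠ 0 ∧
      μ.val f = μ.val (algebraMap L (RatFunc L) d * linearFun a ^ n) ∧
      ν.val f = ν.val (algebraMap L (RatFunc L) d * linearFun a ^ n)) ?_ ?_ ?_ ?_ hf
    · intro c hc
      exact ⟨c, 0, hc, by simp, by simp⟩
    · intro c
      rcases le_or_gt (μ.val (linearFun a)) (μ.val (algebraMap L (RatFunc L) (c - a))) with k | k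
      · refine ⟨1, 1, one_ne_zero, ?_, ?_⟩
        · rw [hμ.linear_eq, min_eq_left k]; simp
        · rw [hν.linear_eq, min_eq_left]
          · simp
          -- The constant `0` has value `⊤`, which the quasi-cut does not see, so `c = a` is
          -- separate.
          · rcases eq_or_ne c a with rfl | hc
            · simp
            · exact (ge_iff _ (sub_ne_zero.mpr hc)).mp k
      · have hne : c - a ≠ 0 := fun e => by simp [e] at k
        refine ⟨c - a, 0, hne, ?_, ?_⟩
        · rw [hμ.linear_eq, min_eq_right k.le]; simp
        · rw [hν.linear_eq, min_eq_right ((le_iff _ hne).mp k.le)]; simp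
    · rintro f g ⟨d, n, hd, h1, h2⟩ ⟨e, m, he, h3, h4⟩
      refine ⟨d * e, n + m, mul_ne_zero hd he, ?_, ?_⟩
      · rw [AddValuation.map_mul, h1, h3, ← AddValuation.map_mul, zpow_add₀ (linearFun_ne_zero a),
          map_mul (algebraMap L (RatFunc L)), mul_mul_mul_comm]
      · rw [AddValuation.map_mul, h2, h4, ← AddValuation.map_mul, zpow_add₀ (linearFun_ne_zero a),
          map_mul (algebraMap L (RatFunc L)), mul_mul_mul_comm]
    · rintro f hf ⟨d, n, hd, h1, h2⟩
      refine ⟨d⁻¹, -n, inv_ne_zero hd, ?_, ?_⟩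
      · rw [AddValuation.map_inv, h1, ← AddValuation.map_inv, mul_inv, zpow_neg, map_inv₀]
      · rw [AddValuation.map_inv, h2, ← AddValuation.map_inv, mul_inv, zpow_neg, map_inv₀]
  -- With `d = e ^ |n|` the monomial is a power of `e (X - a)` or `e / (X - a)`, whose sign is a
  -- comparison of `μ (X - a)` with one constant.
  have sign : ∀ (d : L) (n : ℤ), d ≠ 0 →
      (0 ≤ μ.val (algebraMap L (RatFunc L) d * linearFun a ^ n) ↔
        0 ≤ ν.val (algebraMap L (RatFunc L) d * linearFun a ^ n)) := by
    intro d n hd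
    rcases lt_trichotomy n 0 with hn | rfl | hn
    · obtain ⟨m, rfl⟩ : ∃ m : ℕ, n = -m := ⟨n.natAbs, by lia⟩
      have hm : 0 < m := by lia
      obtain ⟨e, rfl⟩ := IsAlgClosed.exists_pow_nat_eq d hm
      have he : e ≠ 0 := fun h => hd (by rw [h, zero_pow hm.ne'])
      rw [zpow_neg, zpow_natCast, map_pow, ← inv_pow, ← mul_pow, zero_le_val_pow_iff _ _ hm,
        zero_le_val_pow_iff _ _ hm, mul_comm, zero_le_val_inv_mul_iff _ (linearFun_ne_zero a),
        zero_le_val_inv_mul_iff _ (linearFun_ne_zero a)]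
      exact ge_iff e he
    · simpa using const_le_iff μ ν 1 d
    · obtain ⟨m, rfl⟩ : ∃ m : ℕ, n = m := ⟨n.natAbs, by lia⟩
      have hm : 0 < m := by lia
      obtain ⟨e, rfl⟩ := IsAlgClosed.exists_pow_nat_eq d hm
      have he : e ≠ 0 := fun h => hd (by rw [h, zero_pow hm.ne'])
      have he' : algebraMap L (RatFunc L) e⁻¹ ≠ 0 := by simpa using he
      have e1 : algebraMap L (RatFunc L) e = (algebraMap L (RatFunc L) e⁻¹)⁻¹ := by
        rw [map_inv₀, inv_inv]
      rw [zpow_natCast, map_pow, ← mul_pow, zero_le_val_pow_iff _ _ hm, zero_le_val_pow_iff _ _ hm, e1,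
        zero_le_val_inv_mul_iff _ he', zero_le_val_inv_mul_iff _ he']
      exact le_iff _ (inv_ne_zero he)
  -- Equivalence only requires equal valuation rings, so signs suffice.
  refine Valuation.isEquiv_of_val_le_one (v := AddValuation.toValuation μ.val)
    (v' := AddValuation.toValuation ν.val) fun f => ?_
  show 0 ≤ μ.val f ↔ 0 ≤ ν.val f
  rcases eq_or_ne f 0 with rfl | hf
  · simp
  · obtain ⟨d, n, hd, h1, h2⟩ := form f hf
    rw [h1, h2]
    exact sign d n hd

/-! ### The order -/

/-- This and the next two lemmas treat both alternatives of `Le` at once: constant lower bounds pass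
from `μ` to `ν`, constant upper bounds from `ν` to `μ`. -/
theorem Le.le_of_le {μ ν : ValExt v} (h : Le μ ν) {f : L[X]} (hf : f ≠ 0) (d : L)
    (hd : μ.val (algebraMap L (RatFunc L) d) ≤ μ.val (algebraMap L[X] (RatFunc L) f)) :
    ν.val (algebraMap L (RatFunc L) d) ≤ ν.val (algebraMap L[X] (RatFunc L) f) := by
  rcases h with h | h
  · exact (val_le_iff h _ _).mp hd
  · obtain ⟨c, -, h1, h2⟩ := h f hf
    exact ((const_le_iff μ ν d c).mp (hd.trans h1)).trans h2

theorem Le.lt_of_lt {μ ν : ValExt v} (h : Le μ ν) {f : L[X]} (hf : f ≠ 0) (d : L)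
    (hd : μ.val (algebraMap L (RatFunc L) d) < μ.val (algebraMap L[X] (RatFunc L) f)) :
    ν.val (algebraMap L (RatFunc L) d) < ν.val (algebraMap L[X] (RatFunc L) f) := by
  rcases h with h | h
  · exact not_le.mp fun k => not_le.mpr hd ((val_le_iff h _ _).mpr k)
  · obtain ⟨c, -, h1, h2⟩ := h f hf
    have := hd.trans_le h1
    rw [val_const_lt_iff, ← val_const_lt_iff ν] at this
    exact this.trans_le h2

theorem Le.ge_of_ge {μ ν : ValExt v} (h : Le μ ν) {f : L[X]} (hf : f ≠ 0) (d : L)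
    (hd : ν.val (algebraMap L[X] (RatFunc L) f) ≤ ν.val (algebraMap L (RatFunc L) d)) :
    μ.val (algebraMap L[X] (RatFunc L) f) ≤ μ.val (algebraMap L (RatFunc L) d) :=
  not_lt.mp fun k => not_lt.mpr hd (h.lt_of_lt hf d k)

/-- A point `c` of the `ν`-ball outside the `μ`-ball has `μ (c - a) < μ (X - a)`. The same
inequality for `ν` gives `ν (X - c) < ν (X - a)`, although `c` is a centre of `ν`. -/
theorem Le.qball_subset {μ ν : ValExt v} {a b : L} {δ ε : QuasiCut Γ}
    (hv : ∀ γ : Γ, ∃ c : L, v c = (γ : WithTop Γ)) (hμ : μ.IsMonomialAt a δ)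
    (hν : ν.IsMonomialAt b ε) (h : Le μ ν) : qball v b ε ⊆ qball v a δ := by
  intro c hc
  rw [hμ.mem_qball_iff hv]
  by_contra! k
  have k' := h.lt_of_lt (X_sub_C_ne_zero a) _ k
  have hc' := hν.of_mem_qball hv hc
  have := hc'.le_max a
  rw [linear_eq_of_lt k'] at this
  exact not_lt.mpr this k'

/-- Both inclusions come from testing on `X - a`, using `ν (X - a) ≤ ν (X - b)`. -/
theorem Le.radius_le {μ ν : ValExt v} {a b : L} {δ ε : QuasiCut Γ}
    (hv : ∀ γ : Γ, ∃ c : L, v c = (γ : WithTop Γ)) (hμ : μ.IsMonomialAt a δ)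
    (hν : ν.IsMonomialAt b ε) (h : Le μ ν) : δ ≤ ε := by
  constructor
  · intro γ hγ
    obtain ⟨d, hd⟩ := hv γ
    rw [hν.mem_left d γ hd]
    exact (h.le_of_le (X_sub_C_ne_zero a) d ((hμ.mem_left d γ hd).mp hγ)).trans (hν.le_max a)
  · intro γ hγ
    obtain ⟨d, hd⟩ := hv γ
    rw [hμ.mem_right d γ hd]
    exact h.ge_of_ge (X_sub_C_ne_zero a) d ((hν.le_max a).trans ((hν.mem_right d γ hd).mp hγ))

/-- The inclusion of balls makes `b` a common centre. If the radii differ, some `γ` satisfies `μ (X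
- b) ≤ γ ≤ ν (X - b)`, and `min γ (v (c - b))` interpolates on `X - c`. -/
theorem IsMonomialAt.le_of_le [IsAlgClosed L] {μ ν : ValExt v} {a b : L} {δ ε : QuasiCut Γ}
    (hv : ∀ γ : Γ, ∃ c : L, v c = (γ : WithTop Γ)) (hμ : μ.IsMonomialAt a δ)
    (hν : ν.IsMonomialAt b ε) (hB : qball v b ε ⊆ qball v a δ) (hr : δ ≤ ε) : Le μ ν := by
  have hμb := hμ.of_mem_qball hv (hB (self_mem_qball b ε))
  rcases eq_or_ne δ ε with rfl | hne
  · exact Or.inl (hμb.isEquiv hν)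
  obtain ⟨γ, h1, h2⟩ := QuasiCut.exists_mem_of_lt hr hne
  obtain ⟨d, hd⟩ := hv γ
  have hd0 : d ≠ 0 := (AddValuation.ne_top_iff v).mp (by rw [hd]; exact WithTop.coe_ne_top)
  rw [hμb.mem_right d γ hd] at h1
  rw [hν.mem_left d γ hd] at h2
  refine Or.inr fun f hf => ?_
  refine polynomial_induction (P := fun f => ∃ c : L, c ≠ 0 ∧
    μ.val f ≤ μ.val (algebraMap L (RatFunc L) c) ∧
    ν.val (algebraMap L (RatFunc L) c) ≤ ν.val f) ?_ ?_ ?_ hf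
  · exact fun c hc => ⟨c, hc, le_rfl, le_rfl⟩
  · intro c
    rw [hμb.linear_eq c, hν.linear_eq c]
    rcases le_total (v d) (v (c - b)) with k | k
    · exact ⟨d, hd0, (min_le_left _ _).trans h1, le_min h2 ((ν.val_const_le_iff _ _).mpr k)⟩
    · refine ⟨c - b, fun e => ?_, min_le_right _ _,
        le_min (((ν.val_const_le_iff _ _).mpr k).trans h2) le_rfl⟩
      rw [e, AddValuation.map_zero, hd] at k
      exact WithTop.coe_ne_top (top_le_iff.mp k)
  · rintro f g ⟨c, hc, h3, h4⟩ ⟨e, he, h5, h6⟩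
    refine ⟨c * e, mul_ne_zero hc he, ?_, ?_⟩
    · rw [map_mul (algebraMap L (RatFunc L)), AddValuation.map_mul, AddValuation.map_mul]
      exact add_le_add h3 h5
    · rw [map_mul (algebraMap L (RatFunc L)), AddValuation.map_mul, AddValuation.map_mul]
      exact add_le_add h4 h6

end ValExt

/-! ### Valuation-transcendental extensions -/

/-- The residue field of an integrally closed local domain with algebraically closed fraction field
is algebraically closed. -/
theorem isAlgClosed_residueField {O L : Type*} [CommRing O] [IsDomain O] [IsLocalRing O]
    [IsIntegrallyClosed O] [Field L] [IsAlgClosed L] [Algebra O L] [IsFractionRing O L] :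
    IsAlgClosed (IsLocalRing.ResidueField O) := by
  refine IsAlgClosed.of_exists_root _ fun p hp hirr => ?_
  obtain ⟨q, hq, hdeg, hmon⟩ := lifts_and_natDegree_eq_and_monic
    (f := IsLocalRing.residue O) (p := p)
    ((mem_lifts _).mpr (map_surjective _ IsLocalRing.residue_surjective p)) hp
  have hq0 : q.degree ≠ 0 := fun h =>
    hirr.natDegree_pos.ne' (hdeg ▸ natDegree_eq_zero_iff_degree_le_zero.mpr h.le)
  obtain ⟨y, hy⟩ := IsAlgClosed.exists_aeval_eq_zero L q hq0
  -- The lift `q` is monic, so its root in `L` is integral and descends to `O`.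
  obtain ⟨z, rfl⟩ := (IsIntegrallyClosed.isIntegral_iff (R := O) (K := L)).mp ⟨q, hmon, hy⟩
  refine ⟨IsLocalRing.residue O z, ?_⟩
  rw [aeval_algebraMap_apply, FaithfulSMul.algebraMap_eq_zero_iff] at hy
  rw [← hq, eval_map_apply, ← coe_aeval_eq_eval, hy, map_zero]

namespace ValExt

variable {L : Type u} [Field L] {Γ : Type w} [AddCommGroup Γ] [LinearOrder Γ]
  [IsOrderedAddMonoid Γ] {v : AddValuation L (WithTop Γ)}

theorem zero_lt_val_inv_mul_iff (μ : ValExt v) {f g : RatFunc L} (hf : f ≠ 0) :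
    0 < μ.val (f⁻¹ * g) ↔ μ.val f < μ.val g := by
  rcases eq_or_ne g 0 with rfl | hg
  · simp [lt_top_iff_ne_top, hf]
  · have e : f⁻¹ * g = (g⁻¹ * f)⁻¹ := by rw [mul_inv, inv_inv, mul_comm]
    have h : 0 ≤ μ.val (g⁻¹ * f) ↔ μ.val (f⁻¹ * g) ≤ 0 := by
      have h0 : μ.val (f⁻¹ * g) + μ.val (g⁻¹ * f) = 0 := by
        rw [← AddValuation.map_mul, e, inv_mul_cancel₀ (mul_ne_zero (inv_ne_zero hg) hf),
          AddValuation.map_one]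
      constructor
      · intro k
        rw [← h0]
        exact le_add_of_nonneg_right k
      · intro k
        rw [← h0]
        exact add_le_of_nonpos_left k
    rw [← not_le, ← not_le, ← h, zero_le_val_inv_mul_iff _ hg]

/-- If no value `μ (X - a)` is maximal, then every nonzero rational function is the product of a
constant and a `1`-unit. -/
theorem exists_zero_lt_sub_one [IsAlgClosed L] {μ : ValExt v}
    (h : ∀ a, ∃ c, μ.val (linearFun a) < μ.val (linearFun c)) {f : RatFunc L} (hf : f ≠ 0) :
    ∃ d : L, d ≠ 0 ∧ 0 < μ.val ((algebraMap L (RatFunc L) d)⁻¹ * f - 1) := by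
  have hunit : ∀ g : RatFunc L, 0 < μ.val (g - 1) → μ.val g = 0 := fun g hg => by
    rw [← AddValuation.map_one μ.val] at hg ⊢
    exact AddValuation.map_eq_of_lt_sub _ hg
  refine ratFunc_induction (P := fun f => ∃ d : L, d ≠ 0 ∧
    0 < μ.val ((algebraMap L (RatFunc L) d)⁻¹ * f - 1)) ?_ ?_ ?_ ?_ hf
  · intro c hc
    refine ⟨c, hc, ?_⟩
    rw [inv_mul_cancel₀ (by simpa using hc), sub_self, AddValuation.map_zero]
    exact WithTop.coe_lt_top 0
  · intro a
    obtain ⟨c, hc⟩ := h a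
    have hne : c - a ≠ 0 := fun e => by
      rw [sub_eq_zero.mp e] at hc
      exact lt_irrefl _ hc
    have hne' : algebraMap L (RatFunc L) (c - a) ≠ 0 := (_root_.map_ne_zero _).mpr hne
    -- Since `μ (X - c) > μ (X - a)`, the constant `c - a` is the dominant term of `X - a`.
    have e : linearFun a = algebraMap L (RatFunc L) (c - a) + linearFun c := by
      rw [linearFun_eq_add c a]; ring
    have hval : μ.val (algebraMap L (RatFunc L) (c - a)) < μ.val (linearFun c) := by
      by_contra! k
      refine not_le.mpr hc ?_
      rw [e]
      exact AddValuation.map_le_add _ k le_rfl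
    refine ⟨c - a, hne, ?_⟩
    rw [e, mul_add, inv_mul_cancel₀ hne', add_sub_cancel_left, zero_lt_val_inv_mul_iff _ hne']
    exact hval
  · rintro f g ⟨d, hd, h1⟩ ⟨e, he, h2⟩
    refine ⟨d * e, mul_ne_zero hd he, ?_⟩
    -- 1-units are closed under products: `st - 1 = (s - 1) t + (t - 1)`.
    have key : (algebraMap L (RatFunc L) (d * e))⁻¹ * (f * g) - 1 =
        ((algebraMap L (RatFunc L) d)⁻¹ * f - 1) * ((algebraMap L (RatFunc L) e)⁻¹ * g) +
          ((algebraMap L (RatFunc L) e)⁻¹ * g - 1) := by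
      rw [map_mul (algebraMap L (RatFunc L)), mul_inv]; ring
    rw [key]
    refine AddValuation.map_lt_add _ ?_ h2
    rwa [AddValuation.map_mul, hunit _ h2, add_zero]
  · rintro f hf ⟨d, hd, h1⟩
    refine ⟨d⁻¹, inv_ne_zero hd, ?_⟩
    have hd' : algebraMap L (RatFunc L) d ≠ 0 := by simpa using hd
    have key : (algebraMap L (RatFunc L) d⁻¹)⁻¹ * f⁻¹ - 1 =
        -((algebraMap L (RatFunc L) d)⁻¹ * f)⁻¹ * ((algebraMap L (RatFunc L) d)⁻¹ * f - 1) := by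
      rw [map_inv₀]
      field_simp
      ring
    rw [key, AddValuation.map_mul, AddValuation.map_neg, AddValuation.map_inv, hunit _ h1]
    simpa using h1

/-- Without a maximum every nonzero `f` has the value of a constant, contradicting the case `n = 1`
of the hypothesis. -/
theorem exists_max_of_isValueTranscendental [IsAlgClosed L] {μ : ValExt v}
    (hμ : μ.IsValueTranscendental) : ∃ a, ∀ c, μ.val (linearFun c) ≤ μ.val (linearFun a) := by
  by_contra! h
  obtain ⟨f, hf, hn⟩ := hμ
  obtain ⟨d, hd, hlt⟩ := exists_zero_lt_sub_one h hf
  refine hn 1 one_pos d hd ?_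
  rw [← AddValuation.map_one μ.val] at hlt
  have hval := AddValuation.map_eq_of_lt_sub _ hlt
  have hd' : algebraMap L (RatFunc L) d ≠ 0 := by simpa using hd
  rw [one_smul, ← mul_inv_cancel_left₀ hd' f, AddValuation.map_mul, hval, AddValuation.map_one,
    add_zero]

theorem residue_eq_zero_iff {K G : Type*} [Field K] [AddCommGroup G] [LinearOrder G]
    [IsOrderedAddMonoid G] (u : AddValuation K (WithTop G))
    (y : (AddValuation.toValuation u).valuationSubring) :
    IsLocalRing.residue _ y = 0 ↔ 0 < u y := by
  rw [IsLocalRing.residue_eq_zero_iff]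
  exact (ValuationSubring.valuation_lt_one_iff _ y).trans
    (AddValuation.toValuation u).isEquiv_valuation_valuationSubring.lt_one_iff_lt_one.symm

/-- Without a maximum, a nonzero `y` in the valuation ring is `d` times a 1-unit, so its residue is
that of `d` and hence algebraic. -/
theorem exists_max_of_isResidueTranscendental [IsAlgClosed L] {μ : ValExt v}
    (hμ : μ.IsResidueTranscendental) : ∃ a, ∀ c, μ.val (linearFun c) ≤ μ.val (linearFun a) := by
  by_contra! h
  obtain ⟨z, hz⟩ := hμ
  obtain ⟨y, rfl⟩ := IsLocalRing.residue_surjective z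
  have hy0 : (y : RatFunc L) ≠ 0 := fun e => by
    have : y = 0 := Subtype.ext e
    rw [this, map_zero] at hz
    exact hz isAlgebraic_zero
  have hy : 0 ≤ μ.val (y : RatFunc L) := y.2
  obtain ⟨d, hd, hlt⟩ := exists_zero_lt_sub_one h hy0
  have hd' : algebraMap L (RatFunc L) d ≠ 0 := by simpa using hd
  have hval : μ.val ((algebraMap L (RatFunc L) d)⁻¹ * y) = 0 := by
    rw [← AddValuation.map_one μ.val] at hlt ⊢
    exact AddValuation.map_eq_of_lt_sub _ hlt
  have hyd : μ.val (y : RatFunc L) = μ.val (algebraMap L (RatFunc L) d) := by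
    rw [← mul_inv_cancel_left₀ hd' (y : RatFunc L), AddValuation.map_mul, hval, add_zero]
  have hdv : 0 ≤ v d := by
    rw [hyd, ← AddValuation.map_one μ.val, ← map_one (algebraMap L (RatFunc L)),
      val_const_le_iff, AddValuation.map_one] at hy
    exact hy
  let t : (AddValuation.toValuation v).valuationSubring := ⟨d, hdv⟩
  have e : IsLocalRing.residue _ y = algebraMap
      (IsLocalRing.ResidueField (AddValuation.toValuation v).valuationSubring)
      (IsLocalRing.ResidueField (AddValuation.toValuation μ.val).valuationSubring)
      (IsLocalRing.residue _ t) := by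
    rw [Valuation.HasExtension.algebraMap_residue_eq_residue_algebraMap, ← sub_eq_zero, ← map_sub,
      residue_eq_zero_iff]
    show 0 < μ.val ((y : RatFunc L) - algebraMap L (RatFunc L) d)
    have : (y : RatFunc L) - algebraMap L (RatFunc L) d =
        algebraMap L (RatFunc L) d * ((algebraMap L (RatFunc L) d)⁻¹ * y - 1) := by
      rw [mul_sub, mul_inv_cancel_left₀ hd', mul_one]
    rw [this, AddValuation.map_mul, ← hyd]
    exact hlt.trans_le (le_add_of_nonneg_left hy)
  rw [e] at hz
  exact hz (isAlgebraic_algebraMap _)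

/-- If `n μ f = μ c` and `c = d ^ n`, then `μ f = μ d`, as ordered groups are torsion-free. -/
theorem isValueTranscendental_of_ne [IsAlgClosed L] {μ : ValExt v} {f : RatFunc L} (hf : f ≠ 0)
    (h : ∀ d : L, d ≠ 0 → μ.val (algebraMap L (RatFunc L) d) ≠ μ.val f) :
    μ.IsValueTranscendental := by
  refine ⟨f, hf, fun n hn c hc e => ?_⟩
  obtain ⟨d, rfl⟩ := IsAlgClosed.exists_pow_nat_eq c hn
  have hd : d ≠ 0 := fun e => hc (by rw [e, zero_pow hn.ne'])
  have hd' : algebraMap L (RatFunc L) d ≠ 0 := by simpa using hd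
  rw [map_pow, ← AddValuation.map_pow] at e
  refine h d hd (le_antisymm ?_ ?_)
  · rw [← zero_le_val_inv_mul_iff _ hd', ← zero_le_val_pow_iff _ _ hn, mul_pow, inv_pow,
      zero_le_val_inv_mul_iff _ (pow_ne_zero n hd')]
    exact e.ge
  · rw [← zero_le_val_inv_mul_iff _ hf, ← zero_le_val_pow_iff _ _ hn, mul_pow, inv_pow,
      zero_le_val_inv_mul_iff _ (pow_ne_zero n hf)]
    exact e.le

/-- The residue field of `v` is algebraically closed, so an algebraic residue of `(X - a)/d` would
equal that of some `s` in `L`. Then `X - (a + d s)` would have a larger value than `X - a`. -/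
theorem isResidueTranscendental_of_max [IsAlgClosed L] {μ : ValExt v} {a : L}
    (hmax : ∀ c, μ.val (linearFun c) ≤ μ.val (linearFun a)) {d : L} (hd : d ≠ 0)
    (hda : μ.val (algebraMap L (RatFunc L) d) = μ.val (linearFun a)) :
    μ.IsResidueTranscendental := by
  have hd' : algebraMap L (RatFunc L) d ≠ 0 := by simpa using hd
  let y : (AddValuation.toValuation μ.val).valuationSubring :=
    ⟨(algebraMap L (RatFunc L) d)⁻¹ * linearFun a,
      (μ.zero_le_val_inv_mul_iff hd').mpr hda.le⟩
  refine ⟨IsLocalRing.residue _ y, fun halg => ?_⟩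
  have : IsAlgClosed (IsLocalRing.ResidueField (AddValuation.toValuation v).valuationSubring) :=
    isAlgClosed_residueField (L := L)
  obtain ⟨t, ht⟩ := halg.isIntegral.mem_range_algebraMap_of_minpoly_splits
    (K := IsLocalRing.ResidueField (AddValuation.toValuation v).valuationSubring)
    (IsAlgClosed.splits _)
  obtain ⟨s, rfl⟩ := IsLocalRing.residue_surjective t
  rw [Valuation.HasExtension.algebraMap_residue_eq_residue_algebraMap, eq_comm, ← sub_eq_zero,
    ← map_sub, residue_eq_zero_iff] at ht
  have ht' : 0 < μ.val ((algebraMap L (RatFunc L) d)⁻¹ * linearFun a -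
    algebraMap L (RatFunc L) s) := ht
  have e : (algebraMap L (RatFunc L) d)⁻¹ * linearFun a - algebraMap L (RatFunc L) s =
      (algebraMap L (RatFunc L) d)⁻¹ * linearFun (a + d * s) := by
    rw [linearFun_eq_add a (a + d * s), sub_add_cancel_left, map_neg, map_mul, mul_add, mul_neg,
      inv_mul_cancel_left₀ hd', sub_eq_add_neg]
  rw [e, zero_lt_val_inv_mul_iff _ hd', hda] at ht'
  exact not_lt.mpr (hmax _) ht'

/-- A valuation is valuation-transcendental if and only if the values `μ (X - c)` have a maximum. -/
theorem isValuationTranscendental_iff [IsAlgClosed L] (μ : ValExt v) :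
    μ.IsValuationTranscendental ↔ ∃ a, ∀ c, μ.val (linearFun c) ≤ μ.val (linearFun a) := by
  constructor
  · rintro (h | h)
    · exact exists_max_of_isResidueTranscendental h
    · exact exists_max_of_isValueTranscendental h
  · rintro ⟨a, ha⟩
    by_cases h : ∃ d : L, d ≠ 0 ∧ μ.val (algebraMap L (RatFunc L) d) = μ.val (linearFun a)
    · obtain ⟨d, hd, hda⟩ := h
      exact Or.inl (isResidueTranscendental_of_max ha hd hda)
    · push Not at h
      exact Or.inr (isValueTranscendental_of_ne (linearFun_ne_zero a) h)

/-- A valuation for which `μ (X - a)` is maximal has `a` as its centre. -/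
theorem exists_isMonomialAt (hv : ∀ γ : Γ, ∃ c : L, v c = (γ : WithTop Γ)) {μ : ValExt v} {a : L}
    (h : ∀ c, μ.val (linearFun c) ≤ μ.val (linearFun a)) : ∃ δ, μ.IsMonomialAt a δ := by
  -- The two halves overlap exactly when `μ (X - a)` is the value of a nonzero constant, which is
  -- the principal case.
  refine ⟨⟨{γ | ∃ d : L, v d = γ ∧ μ.val (algebraMap L (RatFunc L) d) ≤ μ.val (linearFun a)},
    {γ | ∃ d : L, v d = γ ∧ μ.val (linearFun a) ≤ μ.val (algebraMap L (RatFunc L) d)}, ?_, ?_⟩,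
    h, ?_, ?_⟩
  · rintro α ⟨d, hd, h1⟩ β ⟨e, he, h2⟩
    rw [← WithTop.coe_le_coe, ← hd, ← he, ← val_const_le_iff μ]
    exact h1.trans h2
  · refine Set.eq_univ_of_forall fun γ => ?_
    obtain ⟨d, hd⟩ := hv γ
    exact (le_total (μ.val (algebraMap L (RatFunc L) d)) (μ.val (linearFun a))).imp
      (fun k => ⟨d, hd, k⟩) (fun k => ⟨d, hd, k⟩)
  · refine fun d γ hd => ⟨?_, fun k => ⟨d, hd, k⟩⟩
    rintro ⟨e, he, k⟩
    rwa [← (μ.val_const_eq_iff e d).mpr (he.trans hd.symm)]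
  · refine fun d γ hd => ⟨?_, fun k => ⟨d, hd, k⟩⟩
    rintro ⟨e, he, k⟩
    rwa [← (μ.val_const_eq_iff e d).mpr (he.trans hd.symm)]

/-! ### The valuations `ω_{a,δ}` -/

theorem _root_.monomialVal_linearFun {G : Type w} [AddCommGroup G] [LinearOrder G]
    [IsOrderedAddMonoid G] (u : AddValuation L (WithTop G)) (a : L) (x : G) (c : L) :
    monomialVal u a x (linearFun c) = min (x : WithTop G) (u (a - c)) := by
  have ht : taylor a (X - C c) = X + C (a - c) := by
    rw [map_sub, taylor_X, taylor_C, C_sub]; ring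
  rw [linearFun, monomialVal_algebraMap]
  apply le_antisymm
  · have h1 := monomialFun_le u a x (X - C c) 1
    have h0 := monomialFun_le u a x (X - C c) 0
    rw [ht] at h0 h1
    exact le_min (by simpa using h1) (by simpa using h0)
  · rw [le_monomialFun_iff, ht]
    rintro (_ | _ | n)
    · simp
    · simp
    · simp [coeff_X]

theorem isMonomialAt_omegaElem (a : L) (γ : Γ) :
    (omegaElem v a γ).IsMonomialAt a (QuasiCut.principal γ) := by
  have hlin : ∀ c, (omegaElem v a γ).val (linearFun c) = min (γ : WithTop Γ) (v (a - c)) :=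
    monomialVal_linearFun v a γ
  have hself : (omegaElem v a γ).val (linearFun a) = (γ : WithTop Γ) := by
    rw [hlin, sub_self, AddValuation.map_zero]; exact min_eq_left le_top
  have hconst : ∀ d, (omegaElem v a γ).val (algebraMap L (RatFunc L) d) = v d :=
    monomialVal_const v a γ
  refine ⟨fun c => ?_, fun d β hd => ?_, fun d β hd => ?_⟩
  · rw [hself, hlin]; exact min_le_left _ _
  · rw [hself, hconst, hd]; exact WithTop.coe_le_coe.symm
  · rw [hself, hconst, hd]; exact WithTop.coe_le_coe.symm

/-- The symbol `x_δ` lies strictly between the halves, and these cover `Γ`, so its position recovers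
`δ`. -/
theorem isMonomialAt_omegaCut (a : L) (δ : GroupCut Γ) :
    (omegaCut v a δ).IsMonomialAt a δ.toQuasiCut := by
  have hlin : ∀ c, (omegaCut v a δ).val (linearFun c) =
      min (δ.x : WithTop δ.Ext) (cutBaseVal v δ (a - c)) :=
    monomialVal_linearFun (cutBaseVal v δ) a δ.x
  have hself : (omegaCut v a δ).val (linearFun a) = (δ.x : WithTop δ.Ext) := by
    rw [hlin, sub_self, AddValuation.map_zero]; exact min_eq_left le_top
  have hconst : ∀ (d : L) (β : Γ), v d = β →
      (omegaCut v a δ).val (algebraMap L (RatFunc L) d) = (δ.incl β : WithTop δ.Ext) := by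
    intro d β hd
    refine (monomialVal_const (cutBaseVal v δ) a δ.x d).trans ?_
    show δ.incl.withTopMap (v d) = _
    rw [hd]
    rfl
  have hmem : ∀ β, β ∈ δ.left ∨ β ∈ δ.right := fun β => by
    have h : β ∈ δ.left ∪ δ.right := by rw [δ.union_eq]; trivial
    exact h
  refine ⟨fun c => ?_, fun d β hd => ?_, fun d β hd => ?_⟩
  · rw [hself, hlin]; exact min_le_left _ _
  · rw [hself, hconst d β hd]
    refine ⟨fun h => WithTop.coe_le_coe.mpr (δ.incl_lt_x h).le, fun h => ?_⟩
    exact (hmem β).resolve_right fun k =>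
      not_lt.mpr (WithTop.coe_le_coe.mp h) (δ.x_lt_incl k)
  · rw [hself, hconst d β hd]
    refine ⟨fun h => WithTop.coe_le_coe.mpr (δ.x_lt_incl h).le, fun h => ?_⟩
    exact (hmem β).resolve_left fun k =>
      not_lt.mpr (WithTop.coe_le_coe.mp h) (δ.incl_lt_x k)

theorem exists_monomialAt (v : AddValuation L (WithTop Γ)) (a : L) (δ : QuasiCut Γ) :
    ∃ μ : ValExt v, μ.IsMonomialAt a δ := by
  rcases δ.principal_or_cut with ⟨γ, rfl⟩ | ⟨ε, rfl⟩
  · exact ⟨_, isMonomialAt_omegaElem a γ⟩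
  · exact ⟨_, isMonomialAt_omegaCut a ε⟩

end ValExt

/-! ### The isomorphism on pointed balls -/

namespace PointedBall

variable {L : Type u} [Field L] {Γ : Type w} [AddCommGroup Γ] [LinearOrder Γ]
  [IsOrderedAddMonoid Γ] {v : AddValuation L (WithTop Γ)}

/-- A chosen valuation attached to a pointed ball. -/
noncomputable def toValExt (B : PointedBall v) : ValExt v :=
  (ValExt.exists_monomialAt v B.exists_center.choose B.radius).choose

/-- The arbitrary choices in `toValExt` are harmless: any point of the ball serves as centre. -/
theorem isMonomialAt_toValExt (hv : ∀ γ : Γ, ∃ c : L, v c = (γ : WithTop Γ)) (B : PointedBall v)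
    {a : L} (ha : a ∈ B.under) : B.toValExt.IsMonomialAt a B.radius := by
  refine (ValExt.exists_monomialAt v B.exists_center.choose B.radius).choose_spec.of_mem_qball hv ?_
  rwa [← B.exists_center.choose_spec]

theorem exists_center_mem (B : PointedBall v) : ∃ a ∈ B.under, B.under = qball v a B.radius := by
  obtain ⟨a, ha⟩ := B.exists_center
  exact ⟨a, ha ▸ ValExt.self_mem_qball a B.radius, ha⟩

theorem toValExt_le_iff [IsAlgClosed L] (hv : ∀ γ : Γ, ∃ c : L, v c = (γ : WithTop Γ))
    (B C : PointedBall v) : ValExt.Le B.toValExt C.toValExt ↔ B ≤ C := by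
  obtain ⟨a, ha, hB⟩ := B.exists_center_mem
  obtain ⟨b, hb, hC⟩ := C.exists_center_mem
  have h1 := B.isMonomialAt_toValExt hv ha
  have h2 := C.isMonomialAt_toValExt hv hb
  constructor
  · intro h
    refine ⟨?_, h.radius_le hv h1 h2⟩
    rw [hB, hC]
    exact h.qball_subset hv h1 h2
  · rintro ⟨k1, k2⟩
    rw [hB, hC] at k1
    exact h1.le_of_le hv h2 k1 k2

/-- The isomorphism between pointed balls and classes of valuation-transcendental valuations. -/
noncomputable def orderIso [IsAlgClosed L] (hv : ∀ γ : Γ, ∃ c : L, v c = (γ : WithTop Γ)) :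
    PointedBall v ≃o ValTransClass v :=
  RelIso.ofSurjective
    -- Injectivity is automatic: a map that reflects the order is injective by antisymmetry.
    (OrderEmbedding.ofMapLEIff
      (fun B : PointedBall v => (⟨B.toValExt.toClass, B.toValExt,
        B.toValExt.isValuationTranscendental_iff.mpr
          (B.exists_center_mem.imp fun _ ha => (B.isMonomialAt_toValExt hv ha.1).le_max),
        rfl⟩ : ValTransClass v))
      (toValExt_le_iff hv))
    (by
      rintro ⟨_, μ, hμ, rfl⟩
      obtain ⟨a, ha⟩ := μ.isValuationTranscendental_iff.mp hμ
      obtain ⟨δ, hδ⟩ := ValExt.exists_isMonomialAt hv ha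
      refine ⟨ofCenter v a δ, Subtype.ext (Quotient.sound ?_)⟩
      exact ((ofCenter v a δ).isMonomialAt_toValExt hv (ValExt.self_mem_qball a δ)).isEquiv hδ)

/-- Identifies the chosen class with that of `ω_{a,δ}` for every centre `a`, which is the
well-definedness of the assignment. -/
theorem orderIso_ofCenter [IsAlgClosed L] (hv : ∀ γ : Γ, ∃ c : L, v c = (γ : WithTop Γ))
    {μ : ValExt v} {a : L} {δ : QuasiCut Γ} (h : μ.IsMonomialAt a δ) :
    (orderIso hv (ofCenter v a δ) : ValClass v) = μ.toClass :=
  Quotient.sound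
    (((ofCenter v a δ).isMonomialAt_toValExt hv (ValExt.self_mem_qball a δ)).isEquiv h)

end PointedBall

theorem mainTheorem3 {L : Type u} [Field L] [IsAlgClosed L]
    {Γ : Type w} [AddCommGroup Γ] [LinearOrder Γ] [IsOrderedAddMonoid Γ]
    (v : AddValuation L (WithTop Γ)) (hv : ∀ γ : Γ, ∃ c : L, v c = (γ : WithTop Γ)) :
    ∃ e : PointedBall v ≃o ValTransClass v,
      (∀ (a : L) (γ : Γ),
        (e (PointedBall.ofCenter v a (QuasiCut.principal γ)) : ValClass v) =
          (omegaElem v a γ).toClass) ∧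
      ∀ (a : L) (δ : GroupCut Γ),
        (e (PointedBall.ofCenter v a δ.toQuasiCut) : ValClass v) = (omegaCut v a δ).toClass :=
  ⟨PointedBall.orderIso hv,
    fun a γ => PointedBall.orderIso_ofCenter hv (ValExt.isMonomialAt_omegaElem a γ),
    fun a δ => PointedBall.orderIso_ofCenter hv (ValExt.isMonomialAt_omegaCut a δ)⟩
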